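/- Fix infinitely many nonlogical atoms and a set $\Omega$ of agents. CL1-formulas are built from the nonlogical atoms and the logical atoms $\top,\bot$ by $\neg,\wedge,\vee,\to$ and the binary choice operators $\sqcap,\sqcup$. CL1$^\Omega$-formulas are built by $\neg,\wedge,\vee,\to$ from annotated formulas $F^\omega$, where $F$ is a CL1-formula and $\omega\in\Omega$; every subformula occurrence inside $F^\omega$ has matching environment $\omega$. The skeleton of a CL1$^\Omega$-formula $J$, written $\mathrm{skeleton}(J)$, is the CL1-formula obtained by replacing every $F^\omega$ in $J$ by $F$. An occurrence is positive if it lies in the scope of an even number of negations ($E\to F$ being read as $\neg E\vee F$) and negative otherwise; it is a surface occurrence if it is not in the scope of $\sqcap$ or $\sqcup$. A formula is stable if replacing all its surface occurrences of the form $G_1\sqcap G_2$ by $\top$, and all those of the form $G_1\sqcup G_2$ by $\bot$, yields a classical tautology (annotations being disregarded). Provability in CL1$^\Omega$ is generated by two rules. (A) $J$ is derivable if $J$ is stable and every formula is derivable that results from $J$ by replacing a positive surface occurrence of some $G_1\sqcap G_2$, or a negative surface occurrence of some $G_1\sqcup G_2$, by $G_1$ or by $G_2$. (B) $J$ is derivable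 if some formula is derivable that results from $J$ by replacing a negative surface occurrence of some $G_1\sqcap G_2$, or a positive surface occurrence of some $G_1\sqcup G_2$, by $G_1$ or by $G_2$. In both rules the annotation $\omega$ of the annotated formula in which the replacement takes place is kept. An interpretation $*$ sends every nonlogical atom to an elementary game, that is, to a predicate on valuations, where a valuation assigns a natural number to each of the variables $v_0,v_1,\dots$ It extends to a map sending every CL1-formula $F$ to a game $F^*$ played by the machine and its environment: on each valuation, an atom is a game without legal moves, won by the machine iff the atom is true (as $\top$ is, and $\bot$ is not); $\neg$ exchanges the roles of the two players; $\wedge$ and $\vee$ are parallel play of the two components (moves are prefixed by $1.$ or $2.$), in which the machine has to win both, respectively at least one, of the components; $E\to F$ is $\neg E\vee F$; in $F\sqcap G$ the environment, and in $F\sqcup G$ the machine, has to choose one of the two components as the first move, and loses if it never chooses, and the play continues in the chosen component. The player who first makes an illegal move loses. A machine is an interactive algorithm with read access to the valuation and to the position reached so far; between any two of its steps the environment may make any finite number of moves. It wins a game if, on every valuation and for every behavior of the environment, it wins the resulting (finite or infinite) run. A CL1-formula $F$ is valid if for every interpretation $*$ there is a machine that wins $F^*$. **Proposition.** For every CL1$^\Omega$-formula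 $J$, CL1$^\Omega\vdash J$ if and only if $\mathrm{skeleton}(J)$ is valid. -/

import Mathlib

namespace CoL

/-! ### Formulas -/

/-- CL1-formulas. The nonlogical atoms are indexed by `ℕ`; `top` and `bot` are the two logical
atoms; `cand` is choice conjunction, `cor` is choice disjunction. -/
inductive Formula : Type
  | atom (p : ℕ)
  | top
  | bot
  | neg (F : Formula)
  | and (F G : Formula)
  | or (F G : Formula)
  | imp (F G : Formula)
  | cand (F G : Formula)
  | cor (F G : Formula)

/-- CL1^Ω-formulas over a given type of agents; `ann F ω` is the annotated formula `F^ω`. -/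
inductive AFormula (Agent : Type*) : Type _
  | ann (F : Formula) (ω : Agent)
  | neg (H : AFormula Agent)
  | and (H J : AFormula Agent)
  | or (H J : AFormula Agent)
  | imp (H J : AFormula Agent)

/-- The skeleton: every `F^ω` is replaced by `F`. -/
def AFormula.skeleton {Agent : Type*} : AFormula Agent → Formula
  | .ann F _ => F
  | .neg H => .neg H.skeleton
  | .and H J => .and H.skeleton J.skeleton
  | .or H J => .or H.skeleton J.skeleton
  | .imp H J => .imp H.skeleton J.skeleton

/-! ### Elementarization and stability -/

/-- Elementary formulas, i.e. formulas of classical propositional logic. -/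
inductive EFormula : Type
  | atom (p : ℕ)
  | top
  | bot
  | neg (F : EFormula)
  | and (F G : EFormula)
  | or (F G : EFormula)
  | imp (F G : EFormula)

/-- Truth under a classical truth assignment. -/
def EFormula.Holds (v : ℕ → Prop) : EFormula → Prop
  | .atom p => v p
  | .top => True
  | .bot => False
  | .neg F => ¬ F.Holds v
  | .and F G => F.Holds v ∧ G.Holds v
  | .or F G => F.Holds v ∨ G.Holds v
  | .imp F G => F.Holds v → G.Holds v

/-- Validity in classical logic. -/
def EFormula.Tautology (F : EFormula) : Prop := ∀ v : ℕ → Prop, F.Holds v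

/-- Elementarization: every surface occurrence of a choice disjunction becomes `⊥`, every surface
occurrence of a choice conjunction becomes `⊤`. -/
def Formula.elementarization : Formula → EFormula
  | .atom p => .atom p
  | .top => .top
  | .bot => .bot
  | .neg F => .neg F.elementarization
  | .and F G => .and F.elementarization G.elementarization
  | .or F G => .or F.elementarization G.elementarization
  | .imp F G => .imp F.elementarization G.elementarization
  | .cand _ _ => .top
  | .cor _ _ => .bot

/-- Elementarization of CL1^Ω-formulas; annotations are irrelevant for classical validity and are
not recorded in the result. -/
def AFormula.elementarization {Agent : Type*} : AFormula Agent → EFormula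
  | .ann F _ => F.elementarization
  | .neg H => .neg H.elementarization
  | .and H J => .and H.elementarization J.elementarization
  | .or H J => .or H.elementarization J.elementarization
  | .imp H J => .imp H.elementarization J.elementarization

/-- A formula is stable if its elementarization is classically valid. -/
def AFormula.Stable {Agent : Type*} (J : AFormula Agent) : Prop := J.elementarization.Tautology

/-! ### The proof system -/

/-- `Formula.Replace b O R F H`: the formula `H` is the result of replacing in `F` one surface
occurrence of `O` by `R`. The occurrence is positive if `b = true` and negative if `b = false`;
the antecedent of an implication counts as lying in the scope of a negation. -/
inductive Formula.Replace : Bool → Formula → Formula → Formula → Formula → Prop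
  | here (O R : Formula) : Formula.Replace true O R O R
  | neg {b : Bool} {O R F H : Formula} :
      Formula.Replace b O R F H → Formula.Replace (!b) O R (.neg F) (.neg H)
  | andLeft {b : Bool} {O R F H : Formula} (G : Formula) :
      Formula.Replace b O R F H → Formula.Replace b O R (.and F G) (.and H G)
  | andRight {b : Bool} {O R F H : Formula} (G : Formula) :
      Formula.Replace b O R F H → Formula.Replace b O R (.and G F) (.and G H)
  | orLeft {b : Bool} {O R F H : Formula} (G : Formula) :
      Formula.Replace b O R F H → Formula.Replace b O R (.or F G) (.or H G)
  | orRight {b : Bool} {O R F H : Formula} (G : Formula) :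
      Formula.Replace b O R F H → Formula.Replace b O R (.or G F) (.or G H)
  | impLeft {b : Bool} {O R F H : Formula} (G : Formula) :
      Formula.Replace b O R F H → Formula.Replace (!b) O R (.imp F G) (.imp H G)
  | impRight {b : Bool} {O R F H : Formula} (G : Formula) :
      Formula.Replace b O R F H → Formula.Replace b O R (.imp G F) (.imp G H)

/-- `AFormula.Replace b ω O R J K`: the CL1^Ω-formula `K` is the result of replacing in `J` one
surface occurrence of `O` (positive if `b = true`, negative if `b = false`) whose matching
environment is `ω` by `R`, with `ω` staying the matching environment. -/
inductive AFormula.Replace {Agent : Type*} :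
    Bool → Agent → Formula → Formula → AFormula Agent → AFormula Agent → Prop
  | ann {b : Bool} {O R F H : Formula} (ω : Agent) :
      Formula.Replace b O R F H → AFormula.Replace b ω O R (.ann F ω) (.ann H ω)
  | neg {b : Bool} {ω : Agent} {O R : Formula} {J K : AFormula Agent} :
      AFormula.Replace b ω O R J K → AFormula.Replace (!b) ω O R (.neg J) (.neg K)
  | andLeft {b : Bool} {ω : Agent} {O R : Formula} {J K : AFormula Agent} (L : AFormula Agent) :
      AFormula.Replace b ω O R J K → AFormula.Replace b ω O R (.and J L) (.and K L)
  | andRight {b : Bool} {ω : Agent} {O R : Formula} {J K : AFormula Agent} (L : AFormula Agent) :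
      AFormula.Replace b ω O R J K → AFormula.Replace b ω O R (.and L J) (.and L K)
  | orLeft {b : Bool} {ω : Agent} {O R : Formula} {J K : AFormula Agent} (L : AFormula Agent) :
      AFormula.Replace b ω O R J K → AFormula.Replace b ω O R (.or J L) (.or K L)
  | orRight {b : Bool} {ω : Agent} {O R : Formula} {J K : AFormula Agent} (L : AFormula Agent) :
      AFormula.Replace b ω O R J K → AFormula.Replace b ω O R (.or L J) (.or L K)
  | impLeft {b : Bool} {ω : Agent} {O R : Formula} {J K : AFormula Agent} (L : AFormula Agent) :
      AFormula.Replace b ω O R J K → AFormula.Replace (!b) ω O R (.imp J L) (.imp K L)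
  | impRight {b : Bool} {ω : Agent} {O R : Formula} {J K : AFormula Agent} (L : AFormula Agent) :
      AFormula.Replace b ω O R J K → AFormula.Replace b ω O R (.imp L J) (.imp L K)

/-- `K` results from `J` by replacing a positive surface occurrence of some `G₁ ⊓ G₂`, or a
negative surface occurrence of some `G₁ ⊔ G₂`, by `G₁` or `G₂`. -/
def AFormula.EnvChoice {Agent : Type*} (J K : AFormula Agent) : Prop :=
  ∃ (ω : Agent) (G₁ G₂ G : Formula), (G = G₁ ∨ G = G₂) ∧
    (AFormula.Replace true ω (.cand G₁ G₂) G J K ∨ AFormula.Replace false ω (.cor G₁ G₂) G J K)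

/-- `K` results from `J` by replacing a negative surface occurrence of some `G₁ ⊓ G₂`, or a
positive surface occurrence of some `G₁ ⊔ G₂`, by `G₁` or `G₂`. -/
def AFormula.MachineChoice {Agent : Type*} (J K : AFormula Agent) : Prop :=
  ∃ (ω : Agent) (G₁ G₂ G : Formula), (G = G₁ ∨ G = G₂) ∧
    (AFormula.Replace false ω (.cand G₁ G₂) G J K ∨ AFormula.Replace true ω (.cor G₁ G₂) G J K)

/-- Provability in CL1^Ω. -/
inductive AFormula.Provable {Agent : Type*} : AFormula Agent → Prop
  | ruleA {J : AFormula Agent} :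
      J.Stable → (∀ K, J.EnvChoice K → AFormula.Provable K) → AFormula.Provable J
  | ruleB {J K : AFormula Agent} :
      J.MachineChoice K → AFormula.Provable K → AFormula.Provable J

/-! ### Runs -/

/-- The two players: `true` is the machine, `false` is the environment. -/
abbrev Player : Type := Bool

/-- Moves are written as dot-separated strings of numbers; such a string is the list of these
numbers, so that `i.α` is `i :: α`. -/
abbrev Move : Type := List ℕ

/-- A labeled move is a move together with the player who made it. -/
abbrev LabMove : Type := Player × Move

/-- A position is a finite sequence of labeled moves. -/
abbrev Position : Type := List LabMove

/-- A run is a finite or infinite sequence of labeled moves. -/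
abbrev Run : Type := Stream'.Seq LabMove

open Classical in
/-- The run whose initial segments are spelled by the increasing sequence of positions `P`. -/
noncomputable def limitRun (P : ℕ → Position) : Run :=
  ⟨fun n => if h : ∃ k, n < (P k).length then (P (Nat.find h))[n]? else none, by
    intro n hn
    by_cases h : ∃ k, n + 1 < (P k).length
    · have h' : ∃ k, n < (P k).length := ⟨h.choose, by have := h.choose_spec; omega⟩
      have h2 := Nat.find_spec h'
      simp only [dif_pos h'] at hn
      rw [List.getElem?_eq_none_iff] at hn
      omega
    · simp only [dif_neg h]⟩

/-- Interchange of the labels of the two players. -/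
def LabMove.flip (l : LabMove) : LabMove := (!l.1, l.2)

/-- The part of a position that was played in the `i`-th component: the labeled moves whose move
has the form `i.α`, with the prefix `i.` deleted. -/
def Position.proj (i : ℕ) (Φ : Position) : Position :=
  Φ.filterMap fun l => match l.2 with
    | [] => none
    | j :: α => if j = i then some (l.1, α) else none

/-- The part of a run that was played in the `i`-th component. -/
noncomputable def Run.proj (i : ℕ) (Γ : Run) : Run :=
  limitRun fun n => Position.proj i (Γ.take n)

/-- The run with all labels interchanged. -/
def Run.flip (Γ : Run) : Run := Γ.map LabMove.flip

/-! ### Games -/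

/-- A constant game. `legal` is the set of legal positions, and a run is legal when all of its
finite initial segments are. `Wn Γ` says that a legal run `Γ` is won by the machine (its values on
illegal runs are not used: there, the player who made the first illegal move loses). -/
structure ConstGame where
  legal : Set Position
  nil_legal : [] ∈ legal
  prefix_legal : ∀ Φ Ψ : Position, Φ ++ Ψ ∈ legal → Φ ∈ legal
  Wn : Run → Prop

namespace ConstGame

/-- All finite initial segments of the run are legal. -/
def LegalRun (A : ConstGame) (Γ : Run) : Prop := ∀ n, Γ.take n ∈ A.legal

/-- The first illegal move of the run is made by player `p`. -/
def IllegalBy (A : ConstGame) (p : Player) (Γ : Run) : Prop :=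
  ∃ (n : ℕ) (Φ : Position) (m : Move),
    Γ.take n = Φ ++ [(p, m)] ∧ Φ ∈ A.legal ∧ Φ ++ [(p, m)] ∉ A.legal

/-- The machine wins the run: either the environment was the first to move illegally, or the run
is legal and is won by the machine. -/
def WonByMachine (A : ConstGame) (Γ : Run) : Prop :=
  A.IllegalBy false Γ ∨ (A.LegalRun Γ ∧ A.Wn Γ)

/-- The elementary game of a proposition: no legal moves, and the machine wins the empty run iff
the proposition is true. -/
def elementary (P : Prop) : ConstGame where
  legal := {[]}
  nil_legal := rfl
  prefix_legal := by
    intro Φ Ψ h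
    simp only [Set.mem_singleton_iff, List.append_eq_nil_iff] at h ⊢
    exact h.1
  Wn _ := P

/-- Negation: the players switch roles. -/
def neg (A : ConstGame) : ConstGame where
  legal := {Φ | Φ.map LabMove.flip ∈ A.legal}
  nil_legal := A.nil_legal
  prefix_legal := by
    intro Φ Ψ h
    simp only [Set.mem_ofPred_eq, List.map_append] at h ⊢
    exact A.prefix_legal _ _ h
  Wn Γ := ¬ A.Wn Γ.flip

/-- The legal positions of a parallel combination of `A` (component 1) and `B` (component 2). -/
def parLegal (A B : ConstGame) : Set Position :=
  {Φ | (∀ l ∈ Φ, ∃ α : Move, l.2 = 1 :: α ∨ l.2 = 2 :: α) ∧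
    Position.proj 1 Φ ∈ A.legal ∧ Position.proj 2 Φ ∈ B.legal}

theorem parLegal_nil (A B : ConstGame) : [] ∈ parLegal A B :=
  ⟨by simp, A.nil_legal, B.nil_legal⟩

theorem parLegal_prefix (A B : ConstGame) (Φ Ψ : Position) (h : Φ ++ Ψ ∈ parLegal A B) :
    Φ ∈ parLegal A B := by
  obtain ⟨h1, h2, h3⟩ := h
  refine ⟨fun l hl => h1 l (List.mem_append_left _ hl), ?_, ?_⟩
  · apply A.prefix_legal _ (Position.proj 1 Ψ)
    simpa only [Position.proj, List.filterMap_append] using h2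
  · apply B.prefix_legal _ (Position.proj 2 Ψ)
    simpa only [Position.proj, List.filterMap_append] using h3

/-- Parallel conjunction: the machine has to win both components. -/
noncomputable def and (A B : ConstGame) : ConstGame where
  legal := parLegal A B
  nil_legal := parLegal_nil A B
  prefix_legal := parLegal_prefix A B
  Wn Γ := A.Wn (Run.proj 1 Γ) ∧ B.Wn (Run.proj 2 Γ)

/-- Parallel disjunction: the machine has to win at least one component. -/
noncomputable def or (A B : ConstGame) : ConstGame where
  legal := parLegal A B
  nil_legal := parLegal_nil A B
  prefix_legal := parLegal_prefix A B
  Wn Γ := A.Wn (Run.proj 1 Γ) ∨ B.Wn (Run.proj 2 Γ)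

/-- Implication `A → B`, which is `¬A ∨ B`. -/
noncomputable def imp (A B : ConstGame) : ConstGame := or (neg A) B

/-- The choice game in which player `p` has to start by choosing (with move `1` or `2`) one of `A`
and `B`, after which the chosen game is played; `p` loses if no choice is ever made. -/
def choice (p : Player) (A B : ConstGame) : ConstGame where
  legal := {Φ | Φ = [] ∨ (∃ Ψ ∈ A.legal, Φ = (p, [1]) :: Ψ) ∨ (∃ Ψ ∈ B.legal, Φ = (p, [2]) :: Ψ)}
  nil_legal := Or.inl rfl
  prefix_legal := by
    intro Φ Ψ h
    cases Φ with
    | nil => exact Or.inl rfl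
    | cons l Φ =>
      simp only [Set.mem_ofPred_eq, List.cons_append, List.cons.injEq, reduceCtorEq,
        false_or] at h ⊢
      rcases h with ⟨X, hX, h1, h2⟩ | ⟨X, hX, h1, h2⟩
      · exact Or.inl ⟨Φ, A.prefix_legal _ Ψ (h2 ▸ hX), h1, rfl⟩
      · exact Or.inr ⟨Φ, B.prefix_legal _ Ψ (h2 ▸ hX), h1, rfl⟩
  Wn Γ := match Γ.destruct with
    | none => p = false
    | some (l, Δ) => (l.2 = [1] ∧ A.Wn Δ) ∨ (l.2 = [2] ∧ B.Wn Δ)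

/-- Choice conjunction: the environment chooses. -/
def cand (A B : ConstGame) : ConstGame := choice false A B

/-- Choice disjunction: the machine chooses. -/
def cor (A B : ConstGame) : ConstGame := choice true A B

end ConstGame

/-- A valuation assigns a constant (a natural number) to each of the variables
`v₀, v₁, v₂, …`. -/
abbrev Valuation : Type := ℕ → ℕ

/-- A game is a function from valuations to constant games. -/
abbrev Game : Type := Valuation → ConstGame

/-- An interpretation sends each nonlogical atom to an elementary game, that is, to a predicate on
valuations. -/
abbrev Interpretation : Type := ℕ → Valuation → Prop

/-- The game `F^*` denoted by the formula `F` under an interpretation `*`. -/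
noncomputable def Formula.game (I : Interpretation) : Formula → Game
  | .atom p => fun e => ConstGame.elementary (I p e)
  | .top => fun _ => ConstGame.elementary True
  | .bot => fun _ => ConstGame.elementary False
  | .neg F => fun e => (F.game I e).neg
  | .and F G => fun e => (F.game I e).and (G.game I e)
  | .or F G => fun e => (F.game I e).or (G.game I e)
  | .imp F G => fun e => (F.game I e).imp (G.game I e)
  | .cand F G => fun e => (F.game I e).cand (G.game I e)
  | .cor F G => fun e => (F.game I e).cor (G.game I e)

/-! ### Machines -/

/-- An interactive machine. Its internal configuration is coded by a natural number, initially `0`.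
In each clock cycle it reads the position spelled on its run tape and the value of one variable
on its valuation tape (the variable `scan c`, when `c` is the configuration), and computes from
these its next configuration and, possibly, a move that it makes. -/
structure Machine where
  scan : ℕ → ℕ
  step : ℕ × Position × ℕ → ℕ × Option Move
  computable_scan : Computable scan
  computable_step : Computable step

namespace Machine

/-- The configuration and the content of the run tape after `k` clock cycles, when the valuation
is `e` and `u k` are the moves made by the environment during clock cycle `k`. Moves that the
environment makes while the machine computes precede the move of the machine in that cycle. -/
def config (M : Machine) (e : Valuation) (u : ℕ → List Move) : ℕ → ℕ × Position
  | 0 => (0, [])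
  | k + 1 =>
    let c := M.config e u k
    let r := M.step (c.1, c.2, e (M.scan c.1))
    (r.1, c.2 ++ (u k).map (fun m => (false, m)) ++ r.2.toList.map (fun m => (true, m)))

/-- The run that is incrementally spelled on the run tape. -/
noncomputable def run (M : Machine) (e : Valuation) (u : ℕ → List Move) : Run :=
  limitRun fun k => (M.config e u k).2

/-- The machine wins the game: on every valuation, and for every behavior of the environment, the
resulting run is won by the machine. -/
def Wins (M : Machine) (A : Game) : Prop :=
  ∀ (e : Valuation) (u : ℕ → List Move), (A e).WonByMachine (M.run e u)

end Machine

/-- A CL1-formula is valid if for every interpretation there is a machine that wins the game. -/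
def Formula.Valid (F : Formula) : Prop :=
  ∀ I : Interpretation, ∃ M : Machine, M.Wins (F.game I)

end CoL

namespace CoL

/-! ### Finite runs -/

/-! A legal move in the game of a formula resolves one surface choice, and the rest of the play is
the game of the resulting formula. Legal plays are therefore chains of transitions `Formula.Step`
between formulas (`Formula.mem_legal_iff`). Sizes decrease along them, so they are finite, and the
machine wins a play that stops at `G` iff the elementarization of `G` is true
(`Formula.Reach.wn_iff`): an unmade choice is lost by the player who owed it. Annotations affect
neither rule, so provability can be studied on skeletons (`AFormula.provable_iff_skeleton`).

Soundness: a derivation is a strategy. Rule (B) tells the machine which move to make; rule (A) tells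
it that waiting is safe. Only finitely many positions are legal, so the strategy is a finite table
and computable. The environment may make several moves before the machine answers the first; the
machine handles them one at a time, and since moves of different players commute, the real position
always differs from the handled one only by pending environment moves
(`Formula.Synced.processStep`).

Completeness: on an unprovable formula the environment keeps the formula unprovable. By rule (B) no
machine move can leave the unprovable formulas; by rule (A) the environment has a move that stays
among them whenever the formula is stable, and it waits otherwise. The play stops at an unstable
formula, which is false under some truth assignment (`Formula.exists_losing_run`). That assignment
depends on the machine, while the interpretation has to be fixed before the machine. A diagonal
argument removes the dependence: machines are coded injectively by valuations, and at the code of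
`M` the atoms get the truth values that defeat `M` (`Formula.Valid.provable`). -/

theorem take_ofList (Φ : Position) (n : ℕ) : (Stream'.Seq.ofList Φ).take n = Φ.take n := by
  induction n generalizing Φ with
  | zero => simp
  | succ n ih =>
    cases Φ with
    | nil => simp
    | cons l Φ => simp [ih]

theorem Run.flip_ofList (Φ : Position) :
    Run.flip (Stream'.Seq.ofList Φ) = Stream'.Seq.ofList (Φ.map LabMove.flip) := by
  apply Stream'.Seq.ext
  intro n
  simp [Run.flip]

theorem getElem?_eq_of_prefix {Φ Ψ : Position} (h : Φ <+: Ψ) {n : ℕ} (hn : n < Φ.length) :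
    Φ[n]? = Ψ[n]? := by
  obtain ⟨Δ, rfl⟩ := h
  rw [List.getElem?_append_left hn]

theorem prefix_of_le {P : ℕ → Position} (hP : ∀ k, P k <+: P (k + 1)) {i j : ℕ} (hij : i ≤ j) :
    P i <+: P j := by
  induction hij with
  | refl => exact List.prefix_refl _
  | step _ ih => exact ih.trans (hP _)

/-- The definition reads entry `n` at the least stage that is long enough; since the stages extend
each other, any later stage has the same entry. -/
theorem limitRun_get? {P : ℕ → Position} (hP : ∀ k, P k <+: P (k + 1)) {k n : ℕ}
    (h : n < (P k).length) : Stream'.Seq.get? (limitRun P) n = (P k)[n]? := by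
  classical
  have h' : ∃ k, n < (P k).length := ⟨k, h⟩
  have h1 : Stream'.Seq.get? (limitRun P) n = (P (Nat.find h'))[n]? := by
    change (if h : ∃ k, n < (P k).length then (P (Nat.find h))[n]? else none) = _
    rw [dif_pos h']
  rw [h1, getElem?_eq_of_prefix (prefix_of_le hP (Nat.find_min' h' h)) (Nat.find_spec h')]

theorem limitRun_eq_ofList {P : ℕ → Position} (hP : ∀ k, P k <+: P (k + 1)) {k : ℕ}
    (h : ∀ j, k ≤ j → P j = P k) : limitRun P = Stream'.Seq.ofList (P k) := by
  classical
  apply Stream'.Seq.ext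
  intro n
  rw [Stream'.Seq.ofList_get?]
  by_cases hn : n < (P k).length
  · exact limitRun_get? hP hn
  · rw [List.getElem?_eq_none (by omega)]
    have h' : ¬ ∃ k, n < (P k).length := by
      rintro ⟨j, hj⟩
      rcases le_total k j with hkj | hkj
      · rw [h j hkj] at hj
        exact hn hj
      · exact hn (hj.trans_le (prefix_of_le hP hkj).length_le)
    change (if h : ∃ k, n < (P k).length then (P (Nat.find h))[n]? else none) = _
    rw [dif_neg h']

theorem limitRun_take {P : ℕ → Position} (hP : ∀ k, P k <+: P (k + 1)) {k : ℕ} {Φ : Position}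
    (h : Φ <+: P k) : (limitRun P).take Φ.length = Φ := by
  apply List.ext_getElem?
  intro n
  by_cases hn : n < Φ.length
  · rw [Stream'.Seq.getElem?_take, if_pos hn, limitRun_get? hP (hn.trans_le h.length_le),
      getElem?_eq_of_prefix h hn]
  · rw [Stream'.Seq.getElem?_take, if_neg hn, List.getElem?_eq_none (by omega)]

theorem take_prefix_take (Γ : Run) {m n : ℕ} (h : m ≤ n) : Γ.take m <+: Γ.take n := by
  rw [List.prefix_iff_getElem?]
  intro i hi
  have him : i < m := hi.trans_le Stream'.Seq.length_take_le
  rw [← List.getElem?_eq_getElem hi, Stream'.Seq.getElem?_take, Stream'.Seq.getElem?_take, if_pos him,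
    if_pos (him.trans_le h)]

theorem Run.proj_ofList (i : ℕ) (Φ : Position) :
    Run.proj i (Stream'.Seq.ofList Φ) = Stream'.Seq.ofList (Position.proj i Φ) := by
  have h := limitRun_eq_ofList (P := fun n => Position.proj i ((Stream'.Seq.ofList Φ).take n))
    (k := Φ.length) ?_ ?_
  · rw [Run.proj, h]
    simp [take_ofList]
  · exact fun k => List.IsPrefix.filterMap _ (take_prefix_take _ (Nat.le_succ k))
  · intro j hj
    simp [take_ofList, List.take_of_length_le hj]

theorem Position.proj_cons_same (i : ℕ) (p : Player) (m : Move) (Φ : Position) :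
    Position.proj i ((p, i :: m) :: Φ) = (p, m) :: Position.proj i Φ := by
  simp [Position.proj]

theorem Position.proj_cons_of_ne {i j : ℕ} (h : j ≠ i) (p : Player) (m : Move) (Φ : Position) :
    Position.proj i ((p, j :: m) :: Φ) = Position.proj i Φ := by
  simp [Position.proj, h]

/-! ### Deciding the winner of a run -/

namespace ConstGame

/-- The position has an initial segment at which player `p` makes the first illegal move. -/
def Offends (A : ConstGame) (p : Player) (Φ : Position) : Prop :=
  ∃ (Ψ : Position) (m : Move), Ψ ++ [(p, m)] <+: Φ ∧ Ψ ∈ A.legal ∧ Ψ ++ [(p, m)] ∉ A.legal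

theorem legal_of_prefix {A : ConstGame} {Φ Ψ : Position} (h : Φ <+: Ψ) (hΨ : Ψ ∈ A.legal) :
    Φ ∈ A.legal := by
  obtain ⟨Δ, rfl⟩ := h
  exact A.prefix_legal _ _ hΨ

/-- Of two initial segments ending in a first illegal move, the shorter is a prefix of the longer.
If they differed, it would lie in the legal part of the longer one. -/
theorem IllegalBy.unique {A : ConstGame} {p q : Player} {Γ : Run} (hp : A.IllegalBy p Γ)
    (hq : A.IllegalBy q Γ) : p = q := by
  obtain ⟨a, Φ, m, h1, h2, h3⟩ := hp
  obtain ⟨b, Ψ, n, k1, k2, k3⟩ := hq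
  have key : Φ ++ [(p, m)] = Ψ ++ [(q, n)] := by
    rcases le_total a b with hab | hab
    · have h := take_prefix_take Γ hab
      rw [h1, k1, List.prefix_concat_iff] at h
      exact h.resolve_right fun h => h3 (legal_of_prefix h k2)
    · have h := take_prefix_take Γ hab
      rw [h1, k1, List.prefix_concat_iff] at h
      exact (h.resolve_right fun h => k3 (legal_of_prefix h h2)).symm
  have := List.append_inj_right' key rfl
  simp only [List.cons.injEq, Prod.mk.injEq] at this
  exact this.1.1

theorem illegalBy_limitRun {A : ConstGame} {P : ℕ → Position} (hP : ∀ k, P k <+: P (k + 1))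
    {p : Player} {k : ℕ} (h : A.Offends p (P k)) : A.IllegalBy p (limitRun P) := by
  obtain ⟨Ψ, m, h1, h2, h3⟩ := h
  exact ⟨_, Ψ, m, limitRun_take hP h1, h2, h3⟩

theorem not_wonByMachine_of_illegalBy {A : ConstGame} {Γ : Run} (h : A.IllegalBy true Γ) :
    ¬ A.WonByMachine Γ := by
  rintro (h' | ⟨h', -⟩)
  · exact absurd (h.unique h') (by decide)
  · obtain ⟨n, Φ, m, h1, -, h3⟩ := h
    exact h3 (h1 ▸ h' n)

theorem wonByMachine_ofList {A : ConstGame} {Φ : Position} (h : Φ ∈ A.legal) :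
    A.WonByMachine (Stream'.Seq.ofList Φ) ↔ A.Wn (Stream'.Seq.ofList Φ) := by
  have hl : A.LegalRun (Stream'.Seq.ofList Φ) := fun n => by
    rw [take_ofList]
    exact legal_of_prefix (List.take_prefix n Φ) h
  refine ⟨?_, fun h => Or.inr ⟨hl, h⟩⟩
  rintro (⟨n, Ψ, m, h1, -, h3⟩ | h')
  · exact absurd (h1 ▸ hl n) h3
  · exact h'.2

end ConstGame

/-! ### Moves as transitions between formulas -/

/-- `Formula.Step p m F H`: the move `m` by player `p` is legal in the initial position of `F`,
and it turns `F` into `H`. -/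
inductive Formula.Step : Player → Move → Formula → Formula → Prop
  | candLeft (F G : Formula) : Formula.Step false [1] (.cand F G) F
  | candRight (F G : Formula) : Formula.Step false [2] (.cand F G) G
  | corLeft (F G : Formula) : Formula.Step true [1] (.cor F G) F
  | corRight (F G : Formula) : Formula.Step true [2] (.cor F G) G
  | neg {p : Player} {m : Move} {F H : Formula} :
      Formula.Step (!p) m F H → Formula.Step p m (.neg F) (.neg H)
  | andLeft {p : Player} {m : Move} {F H : Formula} (G : Formula) :
      Formula.Step p m F H → Formula.Step p (1 :: m) (.and F G) (.and H G)
  | andRight {p : Player} {m : Move} {F H : Formula} (G : Formula) :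
      Formula.Step p m F H → Formula.Step p (2 :: m) (.and G F) (.and G H)
  | orLeft {p : Player} {m : Move} {F H : Formula} (G : Formula) :
      Formula.Step p m F H → Formula.Step p (1 :: m) (.or F G) (.or H G)
  | orRight {p : Player} {m : Move} {F H : Formula} (G : Formula) :
      Formula.Step p m F H → Formula.Step p (2 :: m) (.or G F) (.or G H)
  | impLeft {p : Player} {m : Move} {F H : Formula} (G : Formula) :
      Formula.Step (!p) m F H → Formula.Step p (1 :: m) (.imp F G) (.imp H G)
  | impRight {p : Player} {m : Move} {F H : Formula} (G : Formula) :
      Formula.Step p m F H → Formula.Step p (2 :: m) (.imp G F) (.imp G H)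

/-- `Formula.Reach F Φ H`: the position `Φ` is legal in `F`, and it turns `F` into `H`. -/
inductive Formula.Reach : Formula → Position → Formula → Prop
  | nil (F : Formula) : Formula.Reach F [] F
  | cons {p : Player} {m : Move} {Φ : Position} {F G H : Formula} :
      Formula.Step p m F G → Formula.Reach G Φ H → Formula.Reach F ((p, m) :: Φ) H

namespace Formula

theorem Step.unique {p : Player} {m : Move} {F G H : Formula} (h : Step p m F G)
    (h' : Step p m F H) : G = H := by
  induction h generalizing H with
  | candLeft | candRight | corLeft | corRight => cases h'; rfl
  | neg _ ih => cases h' with | neg h' => rw [ih h']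
  | andLeft _ _ ih => cases h' with | andLeft _ h' => rw [ih h']
  | andRight _ _ ih => cases h' with | andRight _ h' => rw [ih h']
  | orLeft _ _ ih => cases h' with | orLeft _ h' => rw [ih h']
  | orRight _ _ ih => cases h' with | orRight _ h' => rw [ih h']
  | impLeft _ _ ih => cases h' with | impLeft _ h' => rw [ih h']
  | impRight _ _ ih => cases h' with | impRight _ h' => rw [ih h']

/-- Moves by different players commute. -/
theorem Step.comm {p q : Player} {m n : Move} {F G H : Formula} (hpq : p ≠ q)
    (h : Step p m F G) (h' : Step q n F H) : ∃ K, Step q n G K ∧ Step p m H K := by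
  induction h generalizing q n H with
  -- Only one player can move in a choice formula.
  | candLeft | candRight | corLeft | corRight => cases h' <;> exact absurd rfl hpq
  | neg h ih =>
    cases h' with
    | neg h' =>
      obtain ⟨K, h1, h2⟩ := ih (by simpa using hpq) h'
      exact ⟨_, .neg h1, .neg h2⟩
  | andLeft _ h ih =>
    cases h' with
    | andLeft _ h' =>
      obtain ⟨K, h1, h2⟩ := ih hpq h'
      exact ⟨_, .andLeft _ h1, .andLeft _ h2⟩
    | andRight _ h' => exact ⟨_, .andRight _ h', .andLeft _ h⟩
  | andRight _ h ih =>
    cases h' with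
    | andLeft _ h' => exact ⟨_, .andLeft _ h', .andRight _ h⟩
    | andRight _ h' =>
      obtain ⟨K, h1, h2⟩ := ih hpq h'
      exact ⟨_, .andRight _ h1, .andRight _ h2⟩
  | orLeft _ h ih =>
    cases h' with
    | orLeft _ h' =>
      obtain ⟨K, h1, h2⟩ := ih hpq h'
      exact ⟨_, .orLeft _ h1, .orLeft _ h2⟩
    | orRight _ h' => exact ⟨_, .orRight _ h', .orLeft _ h⟩
  | orRight _ h ih =>
    cases h' with
    | orLeft _ h' => exact ⟨_, .orLeft _ h', .orRight _ h⟩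
    | orRight _ h' =>
      obtain ⟨K, h1, h2⟩ := ih hpq h'
      exact ⟨_, .orRight _ h1, .orRight _ h2⟩
  | impLeft _ h ih =>
    cases h' with
    | impLeft _ h' =>
      obtain ⟨K, h1, h2⟩ := ih (by simpa using hpq) h'
      exact ⟨_, .impLeft _ h1, .impLeft _ h2⟩
    | impRight _ h' => exact ⟨_, .impRight _ h', .impLeft _ h⟩
  | impRight _ h ih =>
    cases h' with
    | impLeft _ h' => exact ⟨_, .impLeft _ h', .impRight _ h⟩
    | impRight _ h' =>
      obtain ⟨K, h1, h2⟩ := ih hpq h'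
      exact ⟨_, .impRight _ h1, .impRight _ h2⟩

theorem Step.sizeOf_lt {p : Player} {m : Move} {F G : Formula} (h : Step p m F G) :
    sizeOf G < sizeOf F := by
  induction h <;> simp only [cand.sizeOf_spec, cor.sizeOf_spec, neg.sizeOf_spec, and.sizeOf_spec,
    or.sizeOf_spec, imp.sizeOf_spec] <;> omega

theorem finite_steps (F : Formula) : {l : LabMove | ∃ G, Step l.1 l.2 F G}.Finite := by
  -- Shared by the three binary connectives; `f` relabels the moves of the left component and is the
  -- flip only for the antecedent of an implication.
  have prep : ∀ (S : Set LabMove) (f : LabMove → LabMove) (i j : ℕ) (T U : Set LabMove),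
      T.Finite → U.Finite → S ⊆ (fun l => (f l).map id (i :: ·)) '' T ∪
        (fun l => (l.1, j :: l.2)) '' U → S.Finite :=
    fun S f i j T U hT hU h => ((hT.image _).union (hU.image _)).subset h
  induction F with
  | atom | top | bot =>
    refine Set.finite_empty.subset ?_
    rintro ⟨p, m⟩ ⟨G, h⟩
    change Step p m _ _ at h
    cases h
  | neg F ih =>
    refine (ih.image LabMove.flip).subset ?_
    rintro ⟨p, m⟩ ⟨G, h⟩
    change Step p m _ _ at h
    cases h with
    | neg h => exact ⟨(!p, m), ⟨_, h⟩, by simp [LabMove.flip]⟩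
  | and F G ihF ihG =>
    refine prep _ id 1 2 _ _ ihF ihG ?_
    rintro ⟨p, m⟩ ⟨G, h⟩
    change Step p m _ _ at h
    cases h with
    | andLeft _ h => exact Or.inl ⟨(p, _), ⟨_, h⟩, rfl⟩
    | andRight _ h => exact Or.inr ⟨(p, _), ⟨_, h⟩, rfl⟩
  | or F G ihF ihG =>
    refine prep _ id 1 2 _ _ ihF ihG ?_
    rintro ⟨p, m⟩ ⟨G, h⟩
    change Step p m _ _ at h
    cases h with
    | orLeft _ h => exact Or.inl ⟨(p, _), ⟨_, h⟩, rfl⟩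
    | orRight _ h => exact Or.inr ⟨(p, _), ⟨_, h⟩, rfl⟩
  | imp F G ihF ihG =>
    refine prep _ LabMove.flip 1 2 _ _ ihF ihG ?_
    rintro ⟨p, m⟩ ⟨G, h⟩
    change Step p m _ _ at h
    cases h with
    | impLeft _ h => exact Or.inl ⟨(!p, _), ⟨_, h⟩, by simp [LabMove.flip]⟩
    | impRight _ h => exact Or.inr ⟨(p, _), ⟨_, h⟩, rfl⟩
  | cand F G | cor F G =>
    refine (Set.toFinite {(false, [1]), (false, [2]), (true, [1]), (true, [2])}).subset ?_
    rintro ⟨p, m⟩ ⟨G, h⟩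
    change Step p m _ _ at h
    cases h <;> simp

theorem reach_cons_iff {p : Player} {m : Move} {Φ : Position} {F H : Formula} :
    Reach F ((p, m) :: Φ) H ↔ ∃ G, Step p m F G ∧ Reach G Φ H :=
  ⟨fun h => by cases h with | cons h1 h2 => exact ⟨_, h1, h2⟩, fun ⟨_, h1, h2⟩ => .cons h1 h2⟩

theorem reach_nil_iff {F H : Formula} : Reach F [] H ↔ F = H :=
  ⟨fun h => by cases h; rfl, fun h => h ▸ .nil F⟩

theorem reach_append_iff {Φ Ψ : Position} {F H : Formula} :
    Reach F (Φ ++ Ψ) H ↔ ∃ G, Reach F Φ G ∧ Reach G Ψ H := by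
  induction Φ generalizing F with
  | nil => simp [reach_nil_iff]
  | cons l Φ ih =>
    obtain ⟨p, m⟩ := l
    simp only [List.cons_append, reach_cons_iff, ih]
    grind

theorem reach_singleton_iff {p : Player} {m : Move} {F H : Formula} :
    Reach F [(p, m)] H ↔ Step p m F H := by
  simp [reach_cons_iff, reach_nil_iff]

theorem Reach.unique {Φ : Position} {F G H : Formula} (h : Reach F Φ G) (h' : Reach F Φ H) :
    G = H := by
  induction h with
  | nil => cases h'; rfl
  | cons h _ ih =>
    cases h' with
    | cons k k' =>
      cases h.unique k
      exact ih k'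

/-- Each transition costs at least one unit of size. This bound is what makes plays come to rest in
both directions of the theorem. -/
theorem Reach.length_add_sizeOf_le {Φ : Position} {F G : Formula} (h : Reach F Φ G) :
    Φ.length + sizeOf G ≤ sizeOf F := by
  induction h with
  | nil => simp
  | cons h _ ih =>
    have := h.sizeOf_lt
    simp only [List.length_cons]
    omega

/-- The tree of plays is finitely branching, and the size of the formula drops along each edge. This
makes strategies finite tables. -/
theorem finite_reach (F : Formula) : {Φ : Position | ∃ G, Reach F Φ G}.Finite := by
  induction h : sizeOf F using Nat.strong_induction_on generalizing F with
  | _ n ih =>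
    have fin : (⋃ l ∈ {l : LabMove | ∃ G, Step l.1 l.2 F G},
        (l :: ·) '' {Φ : Position | ∃ G, Step l.1 l.2 F G ∧ ∃ H, Reach G Φ H}).Finite := by
      refine F.finite_steps.biUnion ?_
      rintro l ⟨G, hG⟩
      refine ((ih _ (h ▸ hG.sizeOf_lt) G rfl).subset ?_).image _
      rintro Φ ⟨G', hG', hΦ⟩
      exact hG.unique hG' ▸ hΦ
    refine ((Set.finite_singleton []).union fin).subset ?_
    rintro Φ ⟨G, hΦ⟩
    cases hΦ with
    | nil => exact Or.inl rfl
    | cons h1 h2 =>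
      exact Or.inr (Set.mem_biUnion (x := (_, _)) ⟨_, h1⟩ ⟨_, ⟨_, h1, _, h2⟩, rfl⟩)

/-- A move commutes with a sequence of moves by the other player. -/
theorem Reach.comm_step {q : Player} {n : Move} {Φ : Position} {F G H : Formula}
    (hΦ : ∀ l ∈ Φ, l.1 ≠ q) (h : Reach F Φ G) (h' : Step q n F H) :
    ∃ K, Step q n G K ∧ Reach H Φ K := by
  induction h generalizing H with
  | nil => exact ⟨H, h', .nil H⟩
  | cons h _ ih =>
    obtain ⟨K, h1, h2⟩ := h.comm (hΦ _ List.mem_cons_self) h'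
    obtain ⟨L, k1, k2⟩ := ih (fun l hl => hΦ l (List.mem_cons_of_mem _ hl)) h1
    exact ⟨L, k1, .cons h2 k2⟩

/-! ### Transitions and games -/

/-- A choice leaves the chosen game by definition; under the other connectives the move only
concerns one component, and the projection to the other one does not see it. -/
theorem Step.cons_mem_legal_iff (I : Interpretation) (e : Valuation) {p : Player} {m : Move}
    {F G : Formula} (h : Step p m F G) (Φ : Position) :
    (p, m) :: Φ ∈ (F.game I e).legal ↔ Φ ∈ (G.game I e).legal := by
  induction h generalizing Φ with
  | candLeft | candRight | corLeft | corRight =>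
    simp [Formula.game, ConstGame.cand, ConstGame.cor, ConstGame.choice]
  | neg _ ih => simp [Formula.game, ConstGame.neg, LabMove.flip, ih]
  | andLeft _ _ ih | andRight _ _ ih | orLeft _ _ ih | orRight _ _ ih | impLeft _ _ ih
  | impRight _ _ ih =>
    simp [Formula.game, ConstGame.and, ConstGame.or, ConstGame.imp, ConstGame.neg,
      ConstGame.parLegal, Position.proj_cons_same, Position.proj_cons_of_ne, LabMove.flip, ih,
      -Prod.forall, -Bool.forall_bool]

theorem Step.wn_cons_iff (I : Interpretation) (e : Valuation) {p : Player} {m : Move}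
    {F G : Formula} (h : Step p m F G) (Φ : Position) :
    (F.game I e).Wn (Stream'.Seq.ofList ((p, m) :: Φ)) ↔ (G.game I e).Wn (Stream'.Seq.ofList Φ) := by
  induction h generalizing Φ with
  | candLeft | candRight | corLeft | corRight =>
    simp [Formula.game, ConstGame.cand, ConstGame.cor, ConstGame.choice]
  | neg _ ih =>
    simp only [Formula.game, ConstGame.neg, Run.flip_ofList, List.map_cons, LabMove.flip, ih]
  | andLeft _ _ ih | andRight _ _ ih | orLeft _ _ ih | orRight _ _ ih | impLeft _ _ ih
  | impRight _ _ ih =>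
    simp [Formula.game, ConstGame.and, ConstGame.or, ConstGame.imp, ConstGame.neg,
      Run.proj_ofList, Run.flip_ofList, Position.proj_cons_same, Position.proj_cons_of_ne,
      LabMove.flip, ih, -Stream'.Seq.ofList_cons]

/-- Elementarization is made for this: an untouched `⊓` is won by the machine and an untouched `⊔`
is lost by it. -/
theorem wn_nil_iff (I : Interpretation) (e : Valuation) (F : Formula) :
    (F.game I e).Wn (Stream'.Seq.ofList []) ↔ F.elementarization.Holds (fun p => I p e) := by
  have proj_nil : ∀ i, Position.proj i [] = [] := fun _ => rfl
  induction F with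
  | atom | top | bot => rfl
  | neg F ih =>
    simp only [Formula.game, ConstGame.neg, Run.flip_ofList, List.map_nil, ih,
      elementarization, EFormula.Holds]
  | and F G ihF ihG | or F G ihF ihG =>
    simp only [Formula.game, ConstGame.and, ConstGame.or, Run.proj_ofList, proj_nil, ihF, ihG,
      elementarization, EFormula.Holds]
  | imp F G ihF ihG =>
    simp only [Formula.game, ConstGame.imp, ConstGame.or, ConstGame.neg, Run.proj_ofList, proj_nil,
      Run.flip_ofList, List.map_nil, ihF, ihG, elementarization, EFormula.Holds, imp_iff_not_or]
  | cand | cor =>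
    simp [Formula.game, ConstGame.cand, ConstGame.cor, ConstGame.choice, elementarization,
      EFormula.Holds]

theorem singleton_mem_parLegal {A B : ConstGame} {p : Player} {m : Move}
    (h : [(p, m)] ∈ ConstGame.parLegal A B) :
    (∃ α, m = 1 :: α ∧ [(p, α)] ∈ A.legal) ∨ ∃ α, m = 2 :: α ∧ [(p, α)] ∈ B.legal := by
  obtain ⟨h1, h2, h3⟩ := h
  obtain ⟨α, rfl | rfl⟩ : ∃ α, m = 1 :: α ∨ m = 2 :: α := h1 _ List.mem_cons_self
  · exact Or.inl ⟨α, rfl, by simpa [Position.proj] using h2⟩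
  · exact Or.inr ⟨α, rfl, by simpa [Position.proj] using h3⟩

theorem exists_step_of_mem_legal {I : Interpretation} {e : Valuation} {p : Player} {m : Move}
    {F : Formula} (h : [(p, m)] ∈ (F.game I e).legal) : ∃ G, Step p m F G := by
  induction F generalizing p m with
  | atom | top | bot => simp [Formula.game, ConstGame.elementary] at h
  | neg F ih =>
    obtain ⟨G, hG⟩ := ih (p := !p) (m := m) h
    exact ⟨_, .neg hG⟩
  | and F G ihF ihG =>
    obtain ⟨α, rfl, h'⟩ | ⟨α, rfl, h'⟩ := singleton_mem_parLegal h
    · exact (ihF h').imp' _ fun _ => .andLeft _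
    · exact (ihG h').imp' _ fun _ => .andRight _
  | or F G ihF ihG =>
    obtain ⟨α, rfl, h'⟩ | ⟨α, rfl, h'⟩ := singleton_mem_parLegal h
    · exact (ihF h').imp' _ fun _ => .orLeft _
    · exact (ihG h').imp' _ fun _ => .orRight _
  | imp F G ihF ihG =>
    obtain ⟨α, rfl, h'⟩ | ⟨α, rfl, h'⟩ := singleton_mem_parLegal h
    · exact (ihF (p := !p) h').imp' _ fun _ => .impLeft _
    · exact (ihG h').imp' _ fun _ => .impRight _
  | cand F G | cor F G =>
    simp only [Formula.game, ConstGame.cand, ConstGame.cor, ConstGame.choice, Set.mem_ofPred_eq,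
      reduceCtorEq, List.cons.injEq, Prod.mk.injEq, false_or] at h
    obtain ⟨_, _, ⟨rfl, rfl⟩, _⟩ | ⟨_, _, ⟨rfl, rfl⟩, _⟩ := h
    · exact ⟨_, by constructor⟩
    · exact ⟨_, by constructor⟩

theorem mem_legal_iff (I : Interpretation) (e : Valuation) (F : Formula) (Φ : Position) :
    Φ ∈ (F.game I e).legal ↔ ∃ G, Reach F Φ G := by
  induction Φ generalizing F with
  | nil => exact ⟨fun _ => ⟨F, .nil F⟩, fun _ => (F.game I e).nil_legal⟩
  | cons l Φ ih =>
    obtain ⟨p, m⟩ := l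
    constructor
    · intro h
      obtain ⟨G, hG⟩ := exists_step_of_mem_legal ((F.game I e).prefix_legal [(p, m)] Φ h)
      obtain ⟨H, hH⟩ := (ih G).1 ((hG.cons_mem_legal_iff I e Φ).1 h)
      exact ⟨H, .cons hG hH⟩
    · rintro ⟨H, hH⟩
      cases hH with
      | cons h1 h2 => exact (h1.cons_mem_legal_iff I e Φ).2 ((ih _).2 ⟨H, h2⟩)

theorem Reach.wn_iff (I : Interpretation) (e : Valuation) {F G : Formula} {Φ : Position}
    (h : Reach F Φ G) :
    (F.game I e).Wn (Stream'.Seq.ofList Φ) ↔ G.elementarization.Holds (fun p => I p e) := by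
  induction h with
  | nil F => exact wn_nil_iff I e F
  | cons h _ ih => rw [h.wn_cons_iff, ih]

end Formula

/-! ### Provability at the level of skeletons -/

/-- Provability in CL1, which disregards annotations. -/
inductive Formula.Provable : Formula → Prop
  | ruleA {F : Formula} : F.elementarization.Tautology →
      (∀ m G, Formula.Step false m F G → Formula.Provable G) → Formula.Provable F
  | ruleB {m : Move} {F G : Formula} :
      Formula.Step true m F G → Formula.Provable G → Formula.Provable F

/-- A positive `⊓` belongs to the environment, and every negation passed on the way out flips both
the sign and the player. -/
theorem Formula.Replace.step_of_cand {b : Bool} {G₁ G₂ R F H : Formula}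
    (h : Formula.Replace b (.cand G₁ G₂) R F H) (hR : R = G₁ ∨ R = G₂) :
    ∃ m, Formula.Step (!b) m F H := by
  generalize hO : Formula.cand G₁ G₂ = O at h
  induction h with
  | here O R =>
    subst hO
    obtain rfl | rfl := hR
    · exact ⟨_, .candLeft _ _⟩
    · exact ⟨_, .candRight _ _⟩
  | neg _ ih => exact (ih hR hO).imp' _ fun _ h => .neg (by simpa using h)
  | andLeft G _ ih => exact (ih hR hO).imp' _ fun _ => .andLeft G
  | andRight G _ ih => exact (ih hR hO).imp' _ fun _ => .andRight G
  | orLeft G _ ih => exact (ih hR hO).imp' _ fun _ => .orLeft G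
  | orRight G _ ih => exact (ih hR hO).imp' _ fun _ => .orRight G
  | impLeft G _ ih => exact (ih hR hO).imp' _ fun _ h => .impLeft G (by simpa using h)
  | impRight G _ ih => exact (ih hR hO).imp' _ fun _ => .impRight G

theorem Formula.Replace.step_of_cor {b : Bool} {G₁ G₂ R F H : Formula}
    (h : Formula.Replace b (.cor G₁ G₂) R F H) (hR : R = G₁ ∨ R = G₂) :
    ∃ m, Formula.Step b m F H := by
  generalize hO : Formula.cor G₁ G₂ = O at h
  induction h with
  | here O R =>
    subst hO
    obtain rfl | rfl := hR
    · exact ⟨_, .corLeft _ _⟩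
    · exact ⟨_, .corRight _ _⟩
  | neg _ ih => exact (ih hR hO).imp' _ fun _ h => .neg (by simpa using h)
  | andLeft G _ ih => exact (ih hR hO).imp' _ fun _ => .andLeft G
  | andRight G _ ih => exact (ih hR hO).imp' _ fun _ => .andRight G
  | orLeft G _ ih => exact (ih hR hO).imp' _ fun _ => .orLeft G
  | orRight G _ ih => exact (ih hR hO).imp' _ fun _ => .orRight G
  | impLeft G _ ih => exact (ih hR hO).imp' _ fun _ h => .impLeft G (by simpa using h)
  | impRight G _ ih => exact (ih hR hO).imp' _ fun _ => .impRight G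

/-- Form of the constructor in which the sign of the conclusion is a variable, avoiding a double
Boolean negation. -/
theorem Formula.Replace.neg' {b : Bool} {O R F H : Formula} (h : Formula.Replace (!b) O R F H) :
    Formula.Replace b O R (.neg F) (.neg H) := by
  simpa using h.neg

theorem Formula.Replace.impLeft' {b : Bool} {O R F H : Formula} (G : Formula)
    (h : Formula.Replace (!b) O R F H) : Formula.Replace b O R (.imp F G) (.imp H G) := by
  simpa using h.impLeft G

theorem Formula.Step.exists_replace {p : Player} {m : Move} {F H : Formula}
    (h : Formula.Step p m F H) :
    ∃ G₁ G₂ G : Formula, (G = G₁ ∨ G = G₂) ∧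
      (Formula.Replace (!p) (.cand G₁ G₂) G F H ∨ Formula.Replace p (.cor G₁ G₂) G F H) := by
  induction h with
  | candLeft F G => exact ⟨F, G, F, .inl rfl, .inl (.here _ _)⟩
  | candRight F G => exact ⟨F, G, G, .inr rfl, .inl (.here _ _)⟩
  | corLeft F G => exact ⟨F, G, F, .inl rfl, .inr (.here _ _)⟩
  | corRight F G => exact ⟨F, G, G, .inr rfl, .inr (.here _ _)⟩
  | neg _ ih =>
    obtain ⟨G₁, G₂, G, hG, h⟩ := ih
    exact ⟨G₁, G₂, G, hG, h.imp (·.neg') (·.neg')⟩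
  | andLeft L _ ih =>
    obtain ⟨G₁, G₂, G, hG, h⟩ := ih
    exact ⟨G₁, G₂, G, hG, h.imp (·.andLeft L) (·.andLeft L)⟩
  | andRight L _ ih =>
    obtain ⟨G₁, G₂, G, hG, h⟩ := ih
    exact ⟨G₁, G₂, G, hG, h.imp (·.andRight L) (·.andRight L)⟩
  | orLeft L _ ih =>
    obtain ⟨G₁, G₂, G, hG, h⟩ := ih
    exact ⟨G₁, G₂, G, hG, h.imp (·.orLeft L) (·.orLeft L)⟩
  | orRight L _ ih =>
    obtain ⟨G₁, G₂, G, hG, h⟩ := ih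
    exact ⟨G₁, G₂, G, hG, h.imp (·.orRight L) (·.orRight L)⟩
  | impLeft L _ ih =>
    obtain ⟨G₁, G₂, G, hG, h⟩ := ih
    exact ⟨G₁, G₂, G, hG, h.imp (·.impLeft' L) (·.impLeft' L)⟩
  | impRight L _ ih =>
    obtain ⟨G₁, G₂, G, hG, h⟩ := ih
    exact ⟨G₁, G₂, G, hG, h.imp (·.impRight L) (·.impRight L)⟩

namespace AFormula

variable {Agent : Type*}

theorem Replace.skeleton {b : Bool} {ω : Agent} {O R : Formula} {J K : AFormula Agent}
    (h : Replace b ω O R J K) : Formula.Replace b O R J.skeleton K.skeleton := by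
  induction h with
  | ann _ h => exact h
  | neg _ ih => exact ih.neg
  | andLeft _ _ ih => exact ih.andLeft _
  | andRight _ _ ih => exact ih.andRight _
  | orLeft _ _ ih => exact ih.orLeft _
  | orRight _ _ ih => exact ih.orRight _
  | impLeft _ _ ih => exact ih.impLeft _
  | impRight _ _ ih => exact ih.impRight _

/-- A replacement of a choice subformula in the skeleton lifts to the annotated formula. -/
theorem exists_replace_of_skeleton {b : Bool} {O R H : Formula} {J : AFormula Agent}
    (hO : ∃ G₁ G₂, O = .cand G₁ G₂ ∨ O = .cor G₁ G₂) (h : Formula.Replace b O R J.skeleton H) :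
    ∃ (ω : Agent) (K : AFormula Agent), K.skeleton = H ∧ Replace b ω O R J K := by
  induction J generalizing b H with
  | ann F ω => exact ⟨ω, .ann H ω, rfl, .ann ω h⟩
  | neg J ih =>
    simp only [AFormula.skeleton] at h
    cases h with
    -- The replaced formula is a choice, so it cannot be the whole of a skeleton whose main
    -- connective is not a choice.
    | here => simp at hO
    | neg h =>
      obtain ⟨ω, K, rfl, hK⟩ := ih h
      exact ⟨ω, .neg K, rfl, hK.neg⟩
  | and J L ihJ ihL =>
    simp only [AFormula.skeleton] at h
    cases h with
    | here => simp at hO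
    | andLeft _ h =>
      obtain ⟨ω, K, rfl, hK⟩ := ihJ h
      exact ⟨ω, .and K L, rfl, hK.andLeft L⟩
    | andRight _ h =>
      obtain ⟨ω, K, rfl, hK⟩ := ihL h
      exact ⟨ω, .and J K, rfl, hK.andRight J⟩
  | or J L ihJ ihL =>
    simp only [AFormula.skeleton] at h
    cases h with
    | here => simp at hO
    | orLeft _ h =>
      obtain ⟨ω, K, rfl, hK⟩ := ihJ h
      exact ⟨ω, .or K L, rfl, hK.orLeft L⟩
    | orRight _ h =>
      obtain ⟨ω, K, rfl, hK⟩ := ihL h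
      exact ⟨ω, .or J K, rfl, hK.orRight J⟩
  | imp J L ihJ ihL =>
    simp only [AFormula.skeleton] at h
    cases h with
    | here => simp at hO
    | impLeft _ h =>
      obtain ⟨ω, K, rfl, hK⟩ := ihJ h
      exact ⟨ω, .imp K L, rfl, hK.impLeft L⟩
    | impRight _ h =>
      obtain ⟨ω, K, rfl, hK⟩ := ihL h
      exact ⟨ω, .imp J K, rfl, hK.impRight J⟩

/-- `K` results from `J` by a choice of player `p`. -/
def Choice (p : Player) (J K : AFormula Agent) : Prop :=
  ∃ (ω : Agent) (G₁ G₂ G : Formula), (G = G₁ ∨ G = G₂) ∧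
    (Replace (!p) ω (.cand G₁ G₂) G J K ∨ Replace p ω (.cor G₁ G₂) G J K)

theorem Choice.exists_step {p : Player} {J K : AFormula Agent} (h : Choice p J K) :
    ∃ m, Formula.Step p m J.skeleton K.skeleton := by
  obtain ⟨ω, G₁, G₂, G, hG, h | h⟩ := h
  · simpa using h.skeleton.step_of_cand hG
  · exact h.skeleton.step_of_cor hG

theorem exists_choice_of_step {p : Player} {m : Move} {J : AFormula Agent} {H : Formula}
    (h : Formula.Step p m J.skeleton H) : ∃ K, Choice p J K ∧ K.skeleton = H := by
  obtain ⟨G₁, G₂, G, hG, h | h⟩ := h.exists_replace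
  · obtain ⟨ω, K, hK, h⟩ := exists_replace_of_skeleton ⟨G₁, G₂, .inl rfl⟩ h
    exact ⟨K, ⟨ω, G₁, G₂, G, hG, .inl h⟩, hK⟩
  · obtain ⟨ω, K, hK, h⟩ := exists_replace_of_skeleton ⟨G₁, G₂, .inr rfl⟩ h
    exact ⟨K, ⟨ω, G₁, G₂, G, hG, .inr h⟩, hK⟩

theorem elementarization_skeleton (J : AFormula Agent) :
    J.skeleton.elementarization = J.elementarization := by
  induction J <;> simp_all [AFormula.skeleton, AFormula.elementarization,
    Formula.elementarization]

/-- `EnvChoice` and `MachineChoice` are `Choice false` and `Choice true`, and choices in `J`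
correspond to transitions of its skeleton in both directions, so derivations can be translated rule
by rule. -/
theorem provable_iff_skeleton (J : AFormula Agent) : J.Provable ↔ J.skeleton.Provable := by
  constructor
  · intro h
    induction h with
    | @ruleA J hJ _ ih =>
      refine .ruleA (by rw [elementarization_skeleton]; exact hJ) fun m G hG => ?_
      obtain ⟨K, hK, rfl⟩ := exists_choice_of_step hG
      exact ih K hK
    | ruleB h _ ih =>
      obtain ⟨m, hm⟩ := Choice.exists_step (p := true) h
      exact .ruleB hm ih
  · intro h
    generalize hF : J.skeleton = F at h
    induction h generalizing J with
    | ruleA hst _ ih =>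
      subst hF
      refine .ruleA (by rw [elementarization_skeleton] at hst; exact hst) fun K hK => ?_
      obtain ⟨m, hm⟩ := Choice.exists_step (p := false) hK
      exact ih m _ hm K rfl
    | ruleB h _ ih =>
      subst hF
      obtain ⟨K, hK, rfl⟩ := exists_choice_of_step h
      exact .ruleB hK (ih K rfl)

end AFormula

/-! ### Auxiliary facts on plays -/

theorem exists_forall_ge_eq_of_monotone {f : ℕ → ℕ} (hf : Monotone f) {b : ℕ}
    (hb : ∀ k, f k ≤ b) : ∃ k, ∀ j, k ≤ j → f j = f k := by
  have hbdd : BddAbove (Set.range f) := ⟨b, by rintro _ ⟨k, rfl⟩; exact hb k⟩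
  obtain ⟨k, hk⟩ := Nat.sSup_mem (Set.range_nonempty f) hbdd
  exact ⟨k, fun j hj => le_antisymm (hk ▸ le_csSup hbdd ⟨j, rfl⟩) (hf hj)⟩

theorem Machine.config_succ (M : Machine) (e : Valuation) (u : ℕ → List Move) (k : ℕ) :
    M.config e u (k + 1) =
      ((M.step ((M.config e u k).1, (M.config e u k).2, e (M.scan (M.config e u k).1))).1,
        (M.config e u k).2 ++ (u k).map (fun m => (false, m)) ++
          (M.step ((M.config e u k).1, (M.config e u k).2,
            e (M.scan (M.config e u k).1))).2.toList.map (fun m => (true, m))) :=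
  rfl

theorem Machine.config_prefix (M : Machine) (e : Valuation) (u : ℕ → List Move) (k : ℕ) :
    (M.config e u k).2 <+: (M.config e u (k + 1)).2 := by
  rw [M.config_succ, List.append_assoc]
  exact List.prefix_append _ _

/-- The environment can follow any strategy that depends on the current position. -/
theorem Machine.exists_environment (M : Machine) (e : Valuation) (σ : Position → List Move) :
    ∃ u : ℕ → List Move, ∀ k, u k = σ (M.config e u k).2 := by
  -- The play against `σ` is built by recursion first, and the environment's moves are then read off
  -- from it.
  let c : ℕ → ℕ × Position := fun k => Nat.rec (0, []) (fun _ c =>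
    let r := M.step (c.1, c.2, e (M.scan c.1))
    (r.1, c.2 ++ (σ c.2).map (fun m => (false, m)) ++ r.2.toList.map (fun m => (true, m)))) k
  have hc : ∀ k, M.config e (fun k => σ (c k).2) k = c k := by
    intro k
    induction k with
    | zero => rfl
    | succ k ih => rw [M.config_succ, ih]
  exact ⟨fun k => σ (c k).2, fun k => by rw [hc]⟩

namespace Formula

/-- The position has an initial segment at which player `p` makes the first move that is not a
transition of the formula. -/
def Offends (F : Formula) (p : Player) (Φ : Position) : Prop :=
  ∃ (Ψ : Position) (m : Move) (G : Formula),
    Ψ ++ [(p, m)] <+: Φ ∧ Reach F Ψ G ∧ ¬ ∃ H, Step p m G H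

theorem Offends.mono {F : Formula} {p : Player} {Φ Φ' : Position} (h : F.Offends p Φ)
    (h' : Φ <+: Φ') : F.Offends p Φ' := by
  obtain ⟨Ψ, m, G, h1, h2⟩ := h
  exact ⟨Ψ, m, G, h1.trans h', h2⟩

theorem Offends.game {F : Formula} {p : Player} {Φ : Position} (h : F.Offends p Φ)
    (I : Interpretation) (e : Valuation) : (F.game I e).Offends p Φ := by
  obtain ⟨Ψ, m, G, h1, h2, h3⟩ := h
  refine ⟨Ψ, m, h1, (F.mem_legal_iff I e Ψ).2 ⟨G, h2⟩, fun h => h3 ?_⟩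
  obtain ⟨H, hH⟩ := (F.mem_legal_iff I e _).1 h
  obtain ⟨G', h4, h5⟩ := reach_append_iff.1 hH
  exact ⟨H, h2.unique h4 ▸ reach_singleton_iff.1 h5⟩

theorem Reach.append {F G H : Formula} {Φ Ψ : Position} (h : Reach F Φ G) (h' : Reach G Ψ H) :
    Reach F (Φ ++ Ψ) H :=
  reach_append_iff.2 ⟨G, h, h'⟩

/-- Further moves of one player are either legal or make that player the first offender. -/
theorem Reach.extend {F G : Formula} {Φ : Position} (h : Reach F Φ G) (p : Player)
    (u : List Move) :
    (∃ H, Reach G (u.map fun m => (p, m)) H) ∨ F.Offends p (Φ ++ u.map fun m => (p, m)) := by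
  induction u generalizing Φ G with
  | nil => exact Or.inl ⟨G, .nil G⟩
  | cons m u ih =>
    by_cases hm : ∃ H, Step p m G H
    · obtain ⟨H, hH⟩ := hm
      rcases ih (h.append (reach_singleton_iff.2 hH)) with ⟨K, hK⟩ | hK
      · exact Or.inl ⟨K, .cons hH hK⟩
      · exact Or.inr (by simpa using hK)
    · exact Or.inr ⟨Φ, m, G, by simp, h, hm⟩

/-! ### Completeness -/

/-- Against each machine and on each valuation, the environment can play an unprovable formula in
such a way that the machine loses provided the atoms have suitable truth values. -/
theorem exists_losing_run {F : Formula} (hF : ¬ F.Provable) (M : Machine) (e : Valuation) :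
    ∃ (v : ℕ → Prop) (u : ℕ → List Move), ∀ I : Interpretation, (∀ p, I p e = v p) →
      ¬ (F.game I e).WonByMachine (M.run e u) := by
  -- The environment's answer at `Φ`: at most one move, staying among unprovable formulas, and none
  -- only if the current formula is unstable.
  have hσ : ∀ Φ : Position, ∃ l : List Move, ∀ R, Reach F Φ R → ¬ R.Provable →
      ∃ K, Reach R (l.map fun m => (false, m)) K ∧ ¬ K.Provable ∧
        (l = [] → ¬ R.elementarization.Tautology) := by
    intro Φ
    by_cases h : ∃ R, Reach F Φ R ∧ ¬ R.Provable
    · obtain ⟨R, hR, hRP⟩ := h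
      by_cases hs : R.elementarization.Tautology
      · have : ∃ m K, Step false m R K ∧ ¬ K.Provable := by
          by_contra! hcon
          exact hRP (.ruleA hs hcon)
        obtain ⟨m, K, hK, hKP⟩ := this
        refine ⟨[m], fun R' hR' _ => ?_⟩
        obtain rfl := hR.unique hR'
        exact ⟨K, reach_singleton_iff.2 hK, hKP, by simp⟩
      · refine ⟨[], fun R' hR' _ => ?_⟩
        obtain rfl := hR.unique hR'
        exact ⟨R, .nil R, hRP, fun _ => hs⟩
    · exact ⟨[], fun R hR hRP => absurd ⟨R, hR, hRP⟩ h⟩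
  choose σ hσ using hσ
  obtain ⟨u, hu⟩ := M.exists_environment e σ
  have hpre := M.config_prefix e u
  -- If the machine is the first to move illegally it loses whatever the atoms mean, so any `v` will
  -- do.
  by_cases hoff : ∃ k, F.Offends true (M.config e u k).2
  · obtain ⟨k, hk⟩ := hoff
    exact ⟨fun _ => True, u, fun I _ => ConstGame.not_wonByMachine_of_illegalBy
      (ConstGame.illegalBy_limitRun hpre (hk.game I e))⟩
  · have hinv : ∀ k, ∃ R, Reach F (M.config e u k).2 R ∧ ¬ R.Provable := by
      intro k
      induction k with
      | zero => exact ⟨F, .nil F, hF⟩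
      | succ k ih =>
        obtain ⟨R, hR, hRP⟩ := ih
        obtain ⟨K, hK, hKP, -⟩ := hσ _ R hR hRP
        rw [← hu] at hK
        have hoff' : ¬ F.Offends true (M.config e u (k + 1)).2 := fun h => hoff ⟨_, h⟩
        rw [M.config_succ] at hoff' ⊢
        generalize M.step _ = r at hoff' ⊢
        obtain ⟨c, o⟩ := r
        obtain ⟨H, hH⟩ := ((hR.append hK).extend true o.toList).resolve_right hoff'
        -- If the machine could reach a provable `H` from `K`, then `K` would be provable, by rule
        -- (B) or because `H = K`.
        refine ⟨H, (hR.append hK).append hH, fun hHP => hKP ?_⟩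
        cases o with
        | none => exact reach_nil_iff.1 hH ▸ hHP
        | some m => exact .ruleB (reach_singleton_iff.1 hH) hHP
    obtain ⟨k, hk⟩ := exists_forall_ge_eq_of_monotone
      (f := fun k => (M.config e u k).2.length) (b := sizeOf F)
      (monotone_nat_of_le_succ fun k => (hpre k).length_le)
      (fun k => by
        obtain ⟨R, hR, -⟩ := hinv k
        exact (Nat.le_add_right _ _).trans hR.length_add_sizeOf_le)
    have hconst : ∀ j, k ≤ j → (M.config e u j).2 = (M.config e u k).2 := fun j hj =>
      ((prefix_of_le (P := fun k => (M.config e u k).2) hpre hj).eq_of_length (hk j hj).symm).symm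
    obtain ⟨R, hR, hRP⟩ := hinv k
    obtain ⟨-, -, -, hs⟩ := hσ _ R hR hRP
    -- The play has come to rest, so the environment was silent in cycle `k`; by the choice of `σ`,
    -- `R` is unstable and some `v` falsifies its elementarization.
    have hnil : u k = [] := by
      have h := hk (k + 1) (Nat.le_succ k)
      simp only [M.config_succ, List.length_append, List.length_map] at h
      exact List.length_eq_zero_iff.1 (by omega)
    obtain ⟨v, hv⟩ := not_forall.1 (hs (by rw [← hu, hnil]))
    refine ⟨v, u, fun I hI => ?_⟩
    rw [Machine.run, limitRun_eq_ofList hpre hconst,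
      ConstGame.wonByMachine_ofList ((F.mem_legal_iff I e _).2 ⟨R, hR⟩), hR.wn_iff I e]
    simpa only [hI] using hv

end Formula

/-- A valuation from which the machine can be recovered. -/
noncomputable def Machine.code (M : Machine) : Valuation := fun n =>
  Encodable.encode (M.scan n, (Encodable.decode (α := ℕ × Position × ℕ) n).map M.step)

/-- Entry `n` of the code gives `scan n`, and entry `encode x` gives `step x`. -/
theorem Machine.code_injective : Function.Injective Machine.code := by
  rintro ⟨f, g, hf, hg⟩ ⟨f', g', hf', hg'⟩ h
  have key := fun n => Encodable.encode_injective (congrFun h n)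
  simp only [Prod.mk.injEq] at key
  obtain rfl : f = f' := funext fun n => (key n).1
  obtain rfl : g = g' := funext fun x => by simpa using (key (Encodable.encode x)).2
  rfl

theorem Formula.Valid.provable {F : Formula} (h : F.Valid) : F.Provable := by
  by_contra hF
  choose v u hu using fun M : Machine => exists_losing_run hF M M.code
  -- The diagonal interpretation: at the valuation `M.code` it agrees with `v M`, since no other
  -- machine has this code. It need not be computable.
  obtain ⟨M, hM⟩ := h fun p e => ∃ M : Machine, M.code = e ∧ v M p
  refine hu M _ (fun p => propext ⟨?_, fun hp => ⟨M, rfl, hp⟩⟩) (hM M.code (u M))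
  rintro ⟨M', hM', hp⟩
  exact Machine.code_injective hM' ▸ hp

/-! ### Soundness -/

/-- Induction on the exceptional set: resetting `f` to `b` at one point removes that point, and a
case distinction restores the value. -/
theorem primrec_of_finite_support {α β : Type*} [Primcodable α] [Primcodable β] (b : β)
    (f : α → β) (h : {a | f a ≠ b}.Finite) : Primrec f := by
  classical
  have key : ∀ (S : Finset α) (f : α → β), (∀ a, a ∉ S → f a = b) → Primrec f := by
    intro S
    induction S using Finset.induction_on with
    | empty => exact fun f hf => (Primrec.const b).of_eq fun a => (hf a (by simp)).symm
    | insert a S _ ih =>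
      intro f hf
      have h1 : Primrec fun x => if x = a then b else f x := ih _ fun x hx => by
        by_cases hxa : x = a
        · simp [hxa]
        · simp only [hxa, if_false]
          exact hf x (by simp [hxa, hx])
      refine (Primrec.ite (Primrec.eq.comp Primrec.id (Primrec.const a))
        (Primrec.const (f a)) h1).of_eq fun x => ?_
      by_cases hxa : x = a <;> simp [hxa]
  exact key h.toFinset f fun a ha => by simpa using ha

/-- The moves that the environment has made. -/
def Position.envMoves (Φ : Position) : List Move :=
  Φ.filterMap fun l => bif l.1 then none else some l.2

theorem Position.envMoves_append (Φ Ψ : Position) :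
    Position.envMoves (Φ ++ Ψ) = Position.envMoves Φ ++ Position.envMoves Ψ := by
  simp [Position.envMoves]

theorem Position.envMoves_map_env (u : List Move) :
    Position.envMoves (u.map fun m => (false, m)) = u := by
  simp [Position.envMoves]

theorem Position.envMoves_map_machine (u : List Move) :
    Position.envMoves (u.map fun m => (true, m)) = [] := by
  simp [Position.envMoves]

theorem Position.primrec_envMoves : Primrec Position.envMoves :=
  Primrec.listFilterMap Primrec.id
    (Primrec.cond (Primrec.fst.comp Primrec.snd) (Primrec.const none)
      (Primrec.option_some.comp (Primrec.snd.comp Primrec.snd))).to₂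

/-- The position processed so far that is coded by the configuration. -/
def processed (c : ℕ) : Position := (Encodable.decode c).getD []

/-- One clock cycle of the machine that processes the moves of the environment one by one, and
makes the move `s Ψ` as soon as `Ψ` is the processed position. -/
def processStep (s : Position → Option Move) (x : ℕ × Position × ℕ) : ℕ × Option Move :=
  match s (processed x.1) with
  | some m => (Encodable.encode (processed x.1 ++ [(true, m)]), some m)
  | none =>
    match (Position.envMoves x.2.1)[(Position.envMoves (processed x.1)).length]? with
    | some m => (Encodable.encode (processed x.1 ++ [(false, m)]), none)
    | none => (x.1, none)

theorem primrec_processStep {s : Position → Option Move} (hs : Primrec s) :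
    Primrec (processStep s) := by
  have hp : Primrec processed := Primrec.option_getD.comp Primrec.decode (Primrec.const [])
  have hp1 : Primrec fun x : ℕ × Position × ℕ => processed x.1 := hp.comp Primrec.fst
  have happ : ∀ p : Player, Primrec₂ fun (x : ℕ × Position × ℕ) (m : Move) =>
      Encodable.encode (processed x.1 ++ [(p, m)]) := fun p =>
    Primrec.encode.comp (Primrec.list_concat.comp (hp1.comp Primrec.fst)
      (Primrec.pair (Primrec.const p) Primrec.snd))
  have hlook : Primrec fun x : ℕ × Position × ℕ =>
      (Position.envMoves x.2.1)[(Position.envMoves (processed x.1)).length]? :=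
    Primrec.list_getElem?.comp
      (Position.primrec_envMoves.comp (Primrec.fst.comp Primrec.snd))
      (Primrec.list_length.comp (Position.primrec_envMoves.comp hp1))
  refine (Primrec.option_casesOn (hs.comp hp1)
    (Primrec.option_casesOn hlook (Primrec.pair Primrec.fst (Primrec.const none))
      (Primrec.pair (happ false) (Primrec.const none)).to₂)
    (Primrec.pair (happ true) (Primrec.option_some.comp Primrec.snd)).to₂).of_eq fun x => ?_
  unfold processStep
  rcases s (processed x.1) with _ | m
  · dsimp only
    rcases (Position.envMoves x.2.1)[(Position.envMoves (processed x.1)).length]? with _ | m <;> rfl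
  · rfl

/-- The machine with clock cycles given by `processStep`. -/
def processMachine (s : Position → Option Move) (hs : Primrec s) : Machine where
  scan _ := 0
  step := processStep s
  computable_scan := Computable.const 0
  computable_step := (primrec_processStep hs).to_comp

namespace Formula

/-- The option `o` is a good response of the machine to a provable formula: it is a move that
leads to a provable formula, or the formula is stable and stays provable under the moves of the
environment. -/
def GoodResponse (F : Formula) : Option Move → Prop
  | some m => ∃ G, Step true m F G ∧ G.Provable
  | none => F.elementarization.Tautology ∧ ∀ m G, Step false m F G → G.Provable

theorem Provable.exists_goodResponse {F : Formula} (h : F.Provable) :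
    ∃ o, F.GoodResponse o := by
  cases h with
  | ruleA h1 h2 => exact ⟨none, h1, h2⟩
  | @ruleB m _ G h1 h2 => exact ⟨some m, G, h1, h2⟩

/-- Good responses are chosen at the finitely many legal positions and `none` is taken elsewhere. No
interpretation enters. -/
theorem exists_strategy (F : Formula) : ∃ s : Position → Option Move, Primrec s ∧
    ∀ Ψ G, Reach F Ψ G → G.Provable → G.GoodResponse (s Ψ) := by
  have h : ∀ Ψ : Position, ∃ o : Option Move, ((¬ ∃ G, Reach F Ψ G) → o = none) ∧
      ∀ G, Reach F Ψ G → G.Provable → G.GoodResponse o := by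
    intro Ψ
    by_cases hΨ : ∃ G, Reach F Ψ G ∧ G.Provable
    · obtain ⟨G, hG, hGP⟩ := hΨ
      obtain ⟨o, ho⟩ := hGP.exists_goodResponse
      exact ⟨o, fun h => absurd ⟨G, hG⟩ h, fun G' hG' _ => hG.unique hG' ▸ ho⟩
    · exact ⟨none, fun _ => rfl, fun G hG hGP => absurd ⟨G, hG, hGP⟩ hΨ⟩
  choose s h1 h2 using h
  refine ⟨s, primrec_of_finite_support none s (F.finite_reach.subset fun Ψ hΨ => ?_), h2⟩
  by_contra hcon
  exact hΨ (h1 Ψ hcon)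

/-- The position `P` results from the processed position `Ψ`, which turns `F` into a provable
formula, by moves of the environment that have not been processed yet, up to the order of moves by
different players. -/
def Synced (F : Formula) (Ψ P : Position) : Prop :=
  ∃ (J R : Formula) (w : List Move), Reach F Ψ J ∧ J.Provable ∧
    Position.envMoves P = Position.envMoves Ψ ++ w ∧
    Reach J (w.map fun m => (false, m)) R ∧ Reach F P R

/-- The second conjunct measures progress: a cycle that processes nothing finds no pending moves and
a strategy that waits, so the actual formula is the processed one, and it is stable. -/
theorem Synced.processStep {F : Formula} {s : Position → Option Move}
    (hgood : ∀ Ψ G, Reach F Ψ G → G.Provable → G.GoodResponse (s Ψ)) {c : ℕ} {P : Position}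
    (h : Synced F (processed c) P) (v : List Move)
    (hoff : ¬ F.Offends false (P ++ v.map fun m => (false, m))) (x : ℕ) :
    Synced F (processed (CoL.processStep s (c, P, x)).1)
      (P ++ v.map (fun m => (false, m)) ++
        (CoL.processStep s (c, P, x)).2.toList.map (fun m => (true, m))) ∧
    ((processed (CoL.processStep s (c, P, x)).1).length = (processed c).length + 1 ∨
      (processed (CoL.processStep s (c, P, x)).1).length = (processed c).length ∧
        ∃ R, Reach F P R ∧ R.elementarization.Tautology) := by
  have processed_encode : ∀ Ψ : Position, processed (Encodable.encode Ψ) = Ψ := fun Ψ => by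
    simp [processed]
  obtain ⟨J, R, w, hJ, hJP, hw, hJR, hR⟩ := h
  obtain ⟨R', hR'⟩ := (hR.extend false v).resolve_right hoff
  have hJR' : Reach J ((w ++ v).map fun m => (false, m)) R' := by
    rw [List.map_append]
    exact hJR.append hR'
  have hresp := hgood _ J hJ hJP
  unfold CoL.processStep
  cases hs : s (processed c) with
  | some m =>
    rw [hs] at hresp
    obtain ⟨K, hK, hKP⟩ := hresp
    -- The move was chosen for `J` but is played after the pending moves `w` and the new moves `v`;
    -- it commutes with them.
    obtain ⟨L, hL, hKL⟩ := hJR'.comm_step (q := true) (by simp) hK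
    simp only [processed_encode]
    refine ⟨⟨K, L, w ++ v, hJ.append (reach_singleton_iff.2 hK), hKP, ?_, hKL,
      (hR.append hR').append (reach_singleton_iff.2 hL)⟩, Or.inl (by simp)⟩
    rw [Position.envMoves_append, Position.envMoves_map_machine, Position.envMoves_append,
      Position.envMoves_map_env, hw, Position.envMoves_append]
    simp [Position.envMoves]
  | none =>
    rw [hs] at hresp
    -- The entry looked up is the first pending move; the moves `v` of the current cycle are not
    -- visible yet.
    have hlook : (Position.envMoves P)[(Position.envMoves (processed c)).length]? = w[0]? := by
      rw [hw, List.getElem?_append_right le_rfl, Nat.sub_self]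
    simp only [hlook]
    cases w with
    | nil =>
      obtain rfl := reach_nil_iff.1 hJR
      refine ⟨⟨J, R', v, hJ, hJP, ?_, hJR', by simpa using hR.append hR'⟩,
        Or.inr ⟨rfl, J, hR, hresp.1⟩⟩
      simp [Position.envMoves_append, Position.envMoves_map_env, hw]
    | cons m w =>
      obtain ⟨K, hK, hKR⟩ := reach_cons_iff.1 hJR'
      simp only [List.getElem?_cons_zero, processed_encode]
      refine ⟨⟨K, R', w ++ v, hJ.append (reach_singleton_iff.2 hK), hresp.2 m K hK, ?_, hKR,
        by simpa using hR.append hR'⟩, Or.inl (by simp)⟩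
      simp only [Option.toList_none, List.map_nil, List.append_nil, Position.envMoves_append,
        Position.envMoves_map_env, hw]
      simp [Position.envMoves]

/-- Unless the environment offends, the tape and the processed position are both bounded in length,
so both come to rest; a cycle without progress then certifies that the final formula is stable. -/
theorem processMachine_wins {F : Formula} (hF : F.Provable) {s : Position → Option Move}
    (hs : Primrec s) (hgood : ∀ Ψ G, Reach F Ψ G → G.Provable → G.GoodResponse (s Ψ))
    (I : Interpretation) : (processMachine s hs).Wins (F.game I) := by
  intro e u
  set M := processMachine s hs
  have hpre := M.config_prefix e u
  by_cases hoff : ∃ k, F.Offends false (M.config e u k).2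
  · obtain ⟨k, hk⟩ := hoff
    exact Or.inl (ConstGame.illegalBy_limitRun hpre (hk.game I e))
  have hoff' : ∀ k,
      ¬ F.Offends false ((M.config e u k).2 ++ (u k).map fun m => (false, m)) := fun k h =>
    hoff ⟨k + 1, h.mono (by rw [M.config_succ]; exact List.prefix_append _ _)⟩
  have hsync : ∀ k, Synced F (processed (M.config e u k).1) (M.config e u k).2 := by
    intro k
    induction k with
    -- The initial configuration `0` decodes to the empty position.
    | zero => exact ⟨F, F, [], by simpa [Machine.config, processed] using .nil F, hF,
        by simp [Machine.config, processed, Position.envMoves], .nil F, .nil F⟩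
    | succ k ih => exact (ih.processStep hgood (u k) (hoff' k) (e 0)).1
  have hlen := fun k => ((hsync k).processStep hgood (u k) (hoff' k) (e 0)).2
  have hmono : ∀ k, (processed (M.config e u k).1).length ≤
      (processed (M.config e u (k + 1)).1).length := fun k => by
    rcases hlen k with h | ⟨h, -⟩
    · exact (Nat.le_succ _).trans h.ge
    · exact h.ge
  obtain ⟨i, hi⟩ := exists_forall_ge_eq_of_monotone
    (f := fun k => (M.config e u k).2.length) (b := sizeOf F)
    (monotone_nat_of_le_succ fun k => (hpre k).length_le)
    (fun k => by
      obtain ⟨J, R, w, -, -, -, -, hR⟩ := hsync k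
      exact (Nat.le_add_right _ _).trans hR.length_add_sizeOf_le)
  obtain ⟨j, hj⟩ := exists_forall_ge_eq_of_monotone
    (f := fun k => (processed (M.config e u k).1).length) (b := sizeOf F)
    (monotone_nat_of_le_succ hmono)
    (fun k => by
      obtain ⟨J, R, w, hJ, -⟩ := hsync k
      exact (Nat.le_add_right _ _).trans hJ.length_add_sizeOf_le)
  have hconst : ∀ l, max i j ≤ l → (M.config e u l).2 = (M.config e u (max i j)).2 := fun l hl =>
    ((prefix_of_le (P := fun k => (M.config e u k).2) hpre hl).eq_of_length
      ((hi _ (le_max_left i j)).trans (hi l ((le_max_left i j).trans hl)).symm)).symm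
  have hstay : (processed (M.config e u (max i j + 1)).1).length =
      (processed (M.config e u (max i j)).1).length :=
    (hj _ ((le_max_right i j).trans (Nat.le_succ _))).trans (hj _ (le_max_right i j)).symm
  obtain ⟨R, hR, hst⟩ : ∃ R, Reach F (M.config e u (max i j)).2 R ∧
      R.elementarization.Tautology := by
    rcases hlen (max i j) with h | ⟨-, h⟩
    · exact absurd (hstay.symm.trans h) (by omega)
    · exact h
  rw [Machine.run, limitRun_eq_ofList hpre hconst,
    ConstGame.wonByMachine_ofList ((F.mem_legal_iff I e _).2 ⟨R, hR⟩), hR.wn_iff I e]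
  exact hst _

end Formula

/-- The machine is uniform: the same one wins under every interpretation. -/
theorem Formula.Provable.valid {F : Formula} (h : F.Provable) : F.Valid := by
  obtain ⟨s, hs, hgood⟩ := F.exists_strategy
  exact fun I => ⟨processMachine s hs, processMachine_wins h hs hgood I⟩

end CoL

theorem proposition2 {Agent : Type*} (J : CoL.AFormula Agent) :
    CoL.AFormula.Provable J ↔ CoL.Formula.Valid (CoL.AFormula.skeleton J) := by
  rw [CoL.AFormula.provable_iff_skeleton]
  exact ⟨CoL.Formula.Provable.valid, CoL.Formula.Valid.provable⟩
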